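/- **Theorem 7.** There are absolute constants $C$ and $c$ such that the following holds for every constant $\epsilon>0$. Let $\pi$ be a permutation of $\{0,\dots,n-1\}$ that consists of $\rho$ contiguous incrementing or decrementing runs; that is, the positions $0,\dots,n-1$ can be cut into $\rho$ nonempty intervals of consecutive positions such that on each interval either $\pi(i+1)=\pi(i)+1$ for all consecutive positions $i,i+1$ of the interval, or $\pi(i+1)=\pi(i)-1$ for all of them. Then, on a word RAM with words of $w=\Theta(\lg n)$ bits, $\pi$ can be stored in $O(\rho n^{\epsilon})$ bits such that, given $i$, both $\pi(i)$ and $\pi^{-1}(i)$ can be computed in at most $C(1+1/\epsilon)$ steps, that is, in $O(1/\epsilon)$ time for $\epsilon\le 1$. In detail: for every $\epsilon>0$ there are two fixed programs (one for $\pi$ and one for $\pi^{-1}$), and for every $d$ there is a constant $K=K(\epsilon,d)$, such that for all $n$, all word lengths $w$ with $\lfloor\lg n\rfloor+c\le w\le d\,(\lfloor\lg n\rfloor+1)$ (where $\lfloor\lg 0\rfloor$ is read as $0$), and every $\pi$ and $\rho$ as above, there is a memory content, of at most $K\rho n^{\epsilon}$ bits in total, on which the two programs answer all queries $\pi(i)$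 and $\pi^{-1}(i)$, $0\le i<n$, within $C(1+1/\epsilon)$ steps each. The programs use a fixed number of one-word registers and the usual unit-cost instructions (constants, addition, subtraction, multiplication, integer division, remainder, bitwise operations, shifts, comparison and jumps, reading the memory word at a computed address), and do not modify the memory. -/

import Mathlib

/-! ### Contiguous incrementing or decrementing runs of a permutation -/

/-- The composition `c` of `n` cuts the positions `0, …, n - 1` into `c.length` consecutive
nonempty blocks. It is a decomposition of `π` into contiguous incrementing or decrementing runs
if on each block the values of `π` either go up by exactly `1` from every position to the next,
or go down by exactly `1` from every position to the next. -/
def IsContiguousStrictRuns {n : ℕ} (π : Equiv.Perm (Fin n)) (c : Composition n) : Prop :=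
  ∀ r : Fin c.length,
    (∀ a b : Fin (c.blocksFun r), (b : ℕ) = a + 1 →
      (π (c.embedding r b) : ℕ) = (π (c.embedding r a) : ℕ) + 1) ∨
    (∀ a b : Fin (c.blocksFun r), (b : ℕ) = a + 1 →
      (π (c.embedding r b) : ℕ) + 1 = (π (c.embedding r a) : ℕ))

/-! ### The word RAM

A machine with words of `w` bits. A query program reads a stored data structure, which is a list
of words in a read-only random-access memory, and works in registers that hold one word each. A
program names registers by fixed numbers, so that it uses a constant number of them. -/

namespace WordRAM

/-- The binary operations on words. -/
inductive BinOp where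
  | add | sub | mul | div | mod | and | or | xor | shl | shr

/-- The result of an operation on words of `w` bits: arithmetic is modulo `2 ^ w`, division is
unsigned and rounds down, and the shifts are logical. -/
def BinOp.eval {w : ℕ} : BinOp → BitVec w → BitVec w → BitVec w
  | .add, x, y => x + y
  | .sub, x, y => x - y
  | .mul, x, y => x * y
  | .div, x, y => x / y
  | .mod, x, y => x % y
  | .and, x, y => x &&& y
  | .or, x, y => x ||| y
  | .xor, x, y => x ^^^ y
  | .shl, x, y => x <<< y.toNat
  | .shr, x, y => x >>> y.toNat

/-- The instructions; `dst`, `a`, `b` are register numbers and `target` is a line number. -/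
inductive Instr where
  /-- write a constant into register `dst` -/
  | const (dst : ℕ) (value : ℕ)
  /-- write the result of an operation on registers `a` and `b` into register `dst` -/
  | op (o : BinOp) (dst a b : ℕ)
  /-- write into register `dst` the memory word whose address is in register `a` -/
  | load (dst a : ℕ)
  /-- go to line `target` -/
  | jump (target : ℕ)
  /-- go to line `target` if register `a` equals register `b` -/
  | jumpEq (a b target : ℕ)
  /-- go to line `target` if register `a` is less than register `b` -/
  | jumpLt (a b target : ℕ)

/-- A program: a finite list of instructions, with lines numbered from `0`. The program has
halted when its line counter is outside of the list. -/
abbrev Program := List Instr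

/-- The state of the machine: the line counter and the contents of the registers. -/
structure State (w : ℕ) where
  pc : ℕ
  reg : ℕ → BitVec w

/-- Write the word `x` into register `dst` and go to the next line. -/
def State.write {w : ℕ} (s : State w) (dst : ℕ) (x : BitVec w) : State w :=
  ⟨s.pc + 1, Function.update s.reg dst x⟩

/-- The effect of one instruction on the state, when the memory is `mem`. A word that is read
outside of the memory is `0`. -/
def Instr.exec {w : ℕ} (mem : List (BitVec w)) (s : State w) : Instr → State w
  | .const dst value => s.write dst (BitVec.ofNat w value)
  | .op o dst a b => s.write dst (o.eval (s.reg a) (s.reg b))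
  | .load dst a => s.write dst (mem.getD (s.reg a).toNat 0)
  | .jump target => ⟨target, s.reg⟩
  | .jumpEq a b target => ⟨if s.reg a = s.reg b then target else s.pc + 1, s.reg⟩
  | .jumpLt a b target =>
      ⟨if (s.reg a).toNat < (s.reg b).toNat then target else s.pc + 1, s.reg⟩

/-- One step of the machine; a halted machine stays as it is. -/
def step {w : ℕ} (P : Program) (mem : List (BitVec w)) (s : State w) : State w :=
  match P[s.pc]? with
  | none => s
  | some instr => instr.exec mem s

/-- The initial state: the argument is in register `0` and all other registers are `0`. -/
def init (w x : ℕ) : State w :=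
  ⟨0, Function.update (fun _ => 0) 0 (BitVec.ofNat w x)⟩

/-- Run on the memory `mem` with argument `x`, the program `P` halts after at most `T` steps,
and then register `0` contains the number `y`. -/
def Answers {w : ℕ} (P : Program) (mem : List (BitVec w)) (x y : ℕ) (T : ℝ) : Prop :=
  ∃ t : ℕ, (t : ℝ) ≤ T ∧
    P.length ≤ ((step P mem)^[t] (init w x)).pc ∧
    (((step P mem)^[t] (init w x)).reg 0).toNat = y

end WordRAM

/-!
The permutation is affine with slope `1` or `-1` on each of its `ρ` runs, and so is its inverse on
the images of the runs, which are again intervals (`IsContiguousStrictRuns.affinePieces`). To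
evaluate such a function at `x` it suffices to find the interval of `x` and then to compute
`slope * x + offset` modulo `2 ^ w`.

The interval is found by a radix trie over the starting points of the intervals, with digits of
about `lg n / k` bits and therefore `k` levels, where `k` is about `2 / ε`
(`AffinePieces.stateAfter_trie`). A block of the trie that contains no starting point lies within
one interval, and leads to a constant node of that interval which all further digits lead back to.
Hence every query reads exactly `k` digits, and the program needs no jumps. Each node has a pointer
for each of the at most `2 n ^ (ε / 2)` digits, and there are at most `k + 1` nodes for each
interval; the other factor `n ^ (ε / 2)` is, up to a constant, more than the length of a word
(`size_bound`).

The words are only long enough for addresses up to a constant multiple of `n`, whereas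
`ρ n ^ (ε / 2)` may be larger. If the trie would have more than `n` words, a table of all `n`
values is therefore stored in its place (`AffinePieces.exists_memory`). The same program reads both:
the table is an automaton with digits of zero bits, whose answer is an entry selected by the
argument instead of a constant entry (`WordRAM.DigitAutomaton`). That the program runs the automaton
in memory correctly is `WordRAM.DigitAutomaton.Stored.answers`.
-/

namespace WordRAM

/-! ### Straight-line programs -/

/-- The instruction is not a jump, so that the machine goes on with the next line. -/
def Instr.IsStraight : Instr → Prop
  | .const _ _ => True
  | .op _ _ _ _ => True
  | .load _ _ => True
  | .jump _ => False
  | .jumpEq _ _ _ => False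
  | .jumpLt _ _ _ => False

/-- The state after all instructions of `P` have been executed once, in the order of the list. -/
def execAll {w : ℕ} (mem : List (BitVec w)) (s : State w) (P : Program) : State w :=
  P.foldl (fun s i => i.exec mem s) s

theorem execAll_append {w : ℕ} (mem : List (BitVec w)) (s : State w) (P Q : Program) :
    execAll mem s (P ++ Q) = execAll mem (execAll mem s P) Q :=
  List.foldl_append

theorem Instr.IsStraight.pc_exec {w : ℕ} {i : Instr} (h : i.IsStraight) (mem : List (BitVec w))
    (s : State w) : (i.exec mem s).pc = s.pc + 1 := by
  cases i <;> first | rfl | exact h.elim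

/-- If the line counter is at the beginning of the final part `Q` of a program, and `Q` has no
jumps, then the machine executes `Q` once from beginning to end. -/
theorem iterate_step_append {w : ℕ} (mem : List (BitVec w)) (P Q : Program)
    (hQ : ∀ i ∈ Q, i.IsStraight) (s : State w) (hs : s.pc = P.length) :
    (step (P ++ Q) mem)^[Q.length] s = execAll mem s Q ∧
      (execAll mem s Q).pc = P.length + Q.length := by
  induction Q generalizing P s with
  | nil => simp [execAll, hs]
  | cons i Q ih =>
    have hstep : step (P ++ i :: Q) mem s = i.exec mem s := by
      simp [step, hs]
    have := ih (P ++ [i]) (fun j hj => hQ j (by simp [hj])) (i.exec mem s)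
      (by simp [(hQ i (by simp)).pc_exec, hs])
    rw [List.append_assoc, List.singleton_append] at this
    rw [List.length_cons, Function.iterate_succ_apply, hstep]
    refine ⟨this.1, this.2.trans ?_⟩
    simp; omega

theorem answers_of_isStraight {w : ℕ} {P : Program} (hP : ∀ i ∈ P, i.IsStraight)
    {mem : List (BitVec w)} {x y : ℕ} {T : ℝ} (hT : (P.length : ℝ) ≤ T)
    (hy : ((execAll mem (init w x) P).reg 0).toNat = y) : Answers P mem x y T := by
  have h := iterate_step_append mem [] P hP (init w x) rfl
  rw [List.nil_append] at h
  refine ⟨P.length, hT, ?_, ?_⟩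
  · rw [h.1, h.2]; simp
  · rw [h.1, hy]

/-! ### Automata that read the digits of the argument -/

/-- An automaton that reads an argument digit by digit, in base `2 ^ bits`, and that in its final
state `s` gives the answer `sgn s * x + tab s (scale * x)` to the argument `x`. The table `tab s`
has `width` entries. With `scale = 0` only its entry `0` is used, and the answer is affine in `x`;
with `scale = 1` it may be an arbitrary function of `x`. -/
structure DigitAutomaton (σ : Type) where
  bits : ℕ
  width : ℕ
  scale : ℕ
  next : σ → ℕ → σ
  sgn : σ → ℤ
  tab : σ → ℕ → ℤ

namespace DigitAutomaton

variable {σ : Type} (A : DigitAutomaton σ)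

/-- The state after the `j` most significant ones of the `k` lowest digits of `x`. -/
def stateAfter (k x : ℕ) (s : σ) : ℕ → σ
  | 0 => s
  | j + 1 => A.next (stateAfter k x s j) (x / 2 ^ (A.bits * (k - (j + 1))) % 2 ^ A.bits)

/-- The number of words that represent a state: a pointer for each digit, the sign, the table. -/
def nodeSize : ℕ := 2 ^ A.bits + 1 + A.width

/-- The memory represents the automaton for arguments of `k` digits, the state `s` being stored
from address `addr s` on. The first six words are the number of bits of a digit, that of an
argument, the base, the scale, and the addresses of two initial states. -/
structure Stored {w : ℕ} (k : ℕ) (root : Bool → σ) (addr : σ → ℕ) (mem : List (BitVec w)) :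
    Prop where
  bits : mem.getD 0 0 = BitVec.ofNat w A.bits
  shift : mem.getD 1 0 = BitVec.ofNat w (A.bits * k)
  base : mem.getD 2 0 = BitVec.ofNat w (2 ^ A.bits)
  scale : mem.getD 3 0 = BitVec.ofNat w A.scale
  root_false : mem.getD 4 0 = BitVec.ofNat w (addr (root false))
  root_true : mem.getD 5 0 = BitVec.ofNat w (addr (root true))
  addr_le : ∀ s, addr s + A.nodeSize ≤ 2 ^ w
  next : ∀ s, ∀ d < 2 ^ A.bits, mem.getD (addr s + d) 0 = BitVec.ofNat w (addr (A.next s d))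
  sgn : ∀ s, mem.getD (addr s + 2 ^ A.bits) 0 = BitVec.ofInt w (A.sgn s)
  tab : ∀ s, ∀ z < A.width,
    mem.getD (addr s + 2 ^ A.bits + 1 + z) 0 = BitVec.ofInt w (A.tab s z)

theorem exists_stored [Fintype σ] {w : ℕ} (k : ℕ) (root : Bool → σ)
    (hw : 6 + Fintype.card σ * A.nodeSize ≤ 2 ^ w) :
    ∃ (mem : List (BitVec w)) (addr : σ → ℕ),
      mem.length = 6 + Fintype.card σ * A.nodeSize ∧ A.Stored k root addr mem := by
  classical
  -- The node of the state with number `i` follows the header and the `i` nodes before it.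
  let e := Fintype.equivFin σ
  let addr : σ → ℕ := fun s => 6 + e s * A.nodeSize
  have hpos : 0 < A.nodeSize := by unfold nodeSize; positivity
  let dec : ℕ → σ := fun q => if h : q < Fintype.card σ then e.symm ⟨q, h⟩ else root false
  have hdec : ∀ s, dec (e s) = s := fun s => by simp [dec]
  let node : σ → ℕ → BitVec w := fun s r =>
    if r < 2 ^ A.bits then BitVec.ofNat w (addr (A.next s r))
    else if r = 2 ^ A.bits then BitVec.ofInt w (A.sgn s)
    else BitVec.ofInt w (A.tab s (r - (2 ^ A.bits + 1)))
  let header : List (BitVec w) := [BitVec.ofNat w A.bits, BitVec.ofNat w (A.bits * k),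
    BitVec.ofNat w (2 ^ A.bits), BitVec.ofNat w A.scale, BitVec.ofNat w (addr (root false)),
    BitVec.ofNat w (addr (root true))]
  let mem := header ++ (List.range (Fintype.card σ * A.nodeSize)).map
    fun a => node (dec (a / A.nodeSize)) (a % A.nodeSize)
  have hle : ∀ s, e s * A.nodeSize + A.nodeSize ≤ Fintype.card σ * A.nodeSize := fun s => by
    rw [← Nat.succ_mul]; exact Nat.mul_le_mul_right _ (e s).isLt
  have hnode : ∀ s, ∀ r < A.nodeSize, mem.getD (addr s + r) 0 = node s r := by
    intro s r hr
    have hlt : e s * A.nodeSize + r < Fintype.card σ * A.nodeSize := by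
      have := hle s; omega
    have h1 : (e s * A.nodeSize + r) / A.nodeSize = e s := by
      rw [mul_comm, Nat.mul_add_div hpos, Nat.div_eq_of_lt hr, add_zero]
    have h2 : (e s * A.nodeSize + r) % A.nodeSize = r := by
      rw [mul_comm, Nat.mul_add_mod, Nat.mod_eq_of_lt hr]
    rw [List.getD_append_right _ _ _ _ (by simp [header, addr]; omega)]
    have h3 : addr s + r - header.length = e s * A.nodeSize + r := by
      simp [header, addr]; omega
    rw [h3, List.getD_eq_getElem _ _ (by simpa using hlt)]
    simp [h1, h2, hdec]
  refine ⟨mem, addr, by simp [mem, header]; omega, rfl, rfl, rfl, rfl, rfl, rfl, ?_, ?_, ?_, ?_⟩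
  · intro s
    have := hle s
    simp only [addr]; omega
  · intro s d hd
    rw [hnode s d (by unfold nodeSize; omega)]
    simp [node, hd]
  · intro s
    rw [hnode s _ (by unfold nodeSize; omega)]
    simp [node]
  · intro s z hz
    rw [add_assoc, add_assoc, ← add_assoc _ 1, hnode s _ (by unfold nodeSize; omega)]
    simp only [node]
    rw [if_neg (by omega), if_neg (by omega), Nat.add_sub_cancel_left]

end DigitAutomaton

/-! ### The query program -/

/-- Load the header; the word at address `h` is the address of the initial state. Register `0`
holds the argument, `1` the address of the current state, `2` the number of bits of a digit, `3`
the number of bits not yet read, `4` the base, `5` the scale, and `8` the constant `1`. -/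
def loadHeader (h : ℕ) : Program :=
  [.const 6 h, .load 1 6, .const 6 0, .load 2 6, .const 6 1, .load 3 6, .const 6 2, .load 4 6,
    .const 6 3, .load 5 6, .const 8 1]

/-- Read the next digit and follow the pointer that belongs to it. -/
def readDigit : Program :=
  [.op .sub 3 3 2, .op .shr 6 0 3, .op .mod 6 6 4, .op .add 6 1 6, .load 1 6]

/-- Compute the answer from the sign and the table in the current state. -/
def evalAnswer : Program :=
  [.op .add 1 1 4, .load 6 1, .op .mul 6 6 0, .op .mul 7 5 0, .op .add 1 1 8, .op .add 1 1 7,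
    .load 7 1, .op .add 0 6 7]

/-- Run the automaton on `k` digits; the loop is unrolled. -/
def query (h k : ℕ) : Program :=
  loadHeader h ++ ((List.replicate k readDigit).flatten ++ evalAnswer)

theorem length_query (h k : ℕ) : (query h k).length = 19 + 5 * k := by
  simp [query, loadHeader, readDigit, evalAnswer]; omega

theorem isStraight_query (h k : ℕ) : ∀ i ∈ query h k, i.IsStraight := by
  intro i hi
  simp only [query, List.mem_append, List.mem_flatten, List.mem_replicate] at hi
  rcases hi with hi | ⟨_, ⟨-, rfl⟩, hi⟩ | hi
  · simp only [loadHeader, List.mem_cons, List.not_mem_nil, or_false] at hi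
    rcases hi with rfl | rfl | rfl | rfl | rfl | rfl | rfl | rfl | rfl | rfl | rfl <;> trivial
  · simp only [readDigit, List.mem_cons, List.not_mem_nil, or_false] at hi
    rcases hi with rfl | rfl | rfl | rfl | rfl <;> trivial
  · simp only [evalAnswer, List.mem_cons, List.not_mem_nil, or_false] at hi
    rcases hi with rfl | rfl | rfl | rfl | rfl | rfl | rfl | rfl <;> trivial

namespace DigitAutomaton

variable {σ : Type} (A : DigitAutomaton σ)

/-- The contents of the registers when the automaton is in the state stored at address `a` and
`l` bits of the argument `x` have not been read. -/
structure Registers {w : ℕ} (x a l : ℕ) (s : State w) : Prop where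
  arg : s.reg 0 = BitVec.ofNat w x
  node : s.reg 1 = BitVec.ofNat w a
  bits : s.reg 2 = BitVec.ofNat w A.bits
  left : s.reg 3 = BitVec.ofNat w l
  base : s.reg 4 = BitVec.ofNat w (2 ^ A.bits)
  scale : s.reg 5 = BitVec.ofNat w A.scale
  one : s.reg 8 = BitVec.ofNat w 1

variable {A} {w k : ℕ} {root : Bool → σ} {addr : σ → ℕ} {mem : List (BitVec w)}

theorem Stored.registers_loadHeader (hA : A.Stored k root addr mem) (q : Bool) (hw : 5 < 2 ^ w)
    (x : ℕ) : A.Registers x (addr (root q)) (A.bits * k)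
      (execAll mem (init w x) (loadHeader (if q then 5 else 4))) := by
  have h : ∀ i < 6, (BitVec.ofNat w i).toNat = i := fun i hi => by
    rw [BitVec.toNat_ofNat, Nat.mod_eq_of_lt (by omega)]
  have h1 := hA.bits
  have h2 := hA.shift
  have h3 := hA.base
  have h4 := hA.scale
  have h5 := hA.root_false
  have h6 := hA.root_true
  constructor <;> cases q <;>
    simp only [execAll, loadHeader, List.foldl, Instr.exec, State.write, init,
      Function.update_apply, reduceIte, OfNat.ofNat_ne_zero, OfNat.zero_ne_ofNat,
      OfNat.ofNat_ne_one, OfNat.one_ne_ofNat, Nat.reduceEqDiff, zero_ne_one, Bool.false_eq_true,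
      h 0 (by omega), h 1 (by omega), h 2 (by omega), h 3 (by omega), h 4 (by omega),
      h 5 (by omega), h1, h2, h3, h4, h5, h6]

theorem Stored.registers_readDigit (hA : A.Stored k root addr mem) {x l : ℕ} {s : σ}
    {S : State w} (hx : x < 2 ^ w) (hl : l + A.bits < 2 ^ w)
    (h : A.Registers x (addr s) (l + A.bits) S) :
    A.Registers x (addr (A.next s (x / 2 ^ l % 2 ^ A.bits))) l (execAll mem S readDigit) := by
  have hle := hA.addr_le s
  have hd : x / 2 ^ l % 2 ^ A.bits < 2 ^ A.bits := Nat.mod_lt _ (by positivity)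
  unfold nodeSize at hle
  have hB : 2 ^ A.bits < 2 ^ w := by omega
  have e1 : BitVec.ofNat w (l + A.bits) - BitVec.ofNat w A.bits = BitVec.ofNat w l := by
    rw [BitVec.ofNat_add, BitVec.add_sub_cancel]
  have e2 : (BitVec.ofNat w l).toNat = l := by
    rw [BitVec.toNat_ofNat, Nat.mod_eq_of_lt (by omega)]
  have e3 : (BitVec.ofNat w x >>> l) % BitVec.ofNat w (2 ^ A.bits) =
      BitVec.ofNat w (x / 2 ^ l % 2 ^ A.bits) := by
    apply BitVec.eq_of_toNat_eq
    rw [BitVec.toNat_umod, BitVec.toNat_ushiftRight, BitVec.toNat_ofNat, BitVec.toNat_ofNat,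
      BitVec.toNat_ofNat, Nat.mod_eq_of_lt hx, Nat.mod_eq_of_lt hB, Nat.shiftRight_eq_div_pow,
      Nat.mod_eq_of_lt (a := x / 2 ^ l % 2 ^ A.bits) (by omega)]
  have e4 : (BitVec.ofNat w (addr s) + BitVec.ofNat w (x / 2 ^ l % 2 ^ A.bits)).toNat =
      addr s + x / 2 ^ l % 2 ^ A.bits := by
    rw [← BitVec.ofNat_add, BitVec.toNat_ofNat, Nat.mod_eq_of_lt (by omega)]
  have e5 := hA.next s _ hd
  obtain ⟨h0, h1, h2, h3, h4, h5, h8⟩ := h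
  constructor <;>
    simp only [execAll, readDigit, List.foldl, Instr.exec, State.write, BinOp.eval,
      Function.update_apply, reduceIte, OfNat.zero_ne_ofNat, OfNat.ofNat_ne_one,
      OfNat.one_ne_ofNat, Nat.reduceEqDiff, zero_ne_one,
      h0, h1, h2, h3, h4, h5, h8, e1, e2, e3, e4, e5]

theorem Stored.registers_readDigits (hA : A.Stored k root addr mem) {x : ℕ} {s : σ}
    {S : State w} (hx : x < 2 ^ w) (hk : A.bits * k < 2 ^ w)
    (h : A.Registers x (addr s) (A.bits * k) S) (j : ℕ) (hj : j ≤ k) :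
    A.Registers x (addr (A.stateAfter k x s j)) (A.bits * (k - j))
      (execAll mem S (List.replicate j readDigit).flatten) := by
  induction j with
  | zero => exact h
  | succ j ih =>
    have hl : A.bits * (k - j) = A.bits * (k - (j + 1)) + A.bits := by
      rw [← Nat.mul_succ]; congr 1; omega
    have hle : A.bits * (k - j) ≤ A.bits * k := Nat.mul_le_mul_left _ (Nat.sub_le _ _)
    rw [List.replicate_succ', List.flatten_append, List.flatten_singleton, execAll_append]
    have := ih (by omega)
    rw [hl] at this
    exact hA.registers_readDigit hx (by omega) this

theorem Stored.reg_evalAnswer (hA : A.Stored k root addr mem) {x y l : ℕ} {s : σ}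
    {S : State w} (hx : A.scale * x < A.width) (h : A.Registers x (addr s) l S)
    (hy : A.sgn s * x + A.tab s (A.scale * x) = y) :
    (execAll mem S evalAnswer).reg 0 = BitVec.ofNat w y := by
  have hle := hA.addr_le s
  unfold nodeSize at hle
  have e1 : (BitVec.ofNat w (addr s) + BitVec.ofNat w (2 ^ A.bits)).toNat =
      addr s + 2 ^ A.bits := by
    rw [← BitVec.ofNat_add, BitVec.toNat_ofNat, Nat.mod_eq_of_lt (by omega)]
  have e2 : (BitVec.ofNat w (addr s) + BitVec.ofNat w (2 ^ A.bits) +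
      BitVec.ofNat w 1 + BitVec.ofNat w A.scale * BitVec.ofNat w x).toNat =
      addr s + 2 ^ A.bits + 1 + A.scale * x := by
    rw [← BitVec.ofNat_mul, ← BitVec.ofNat_add, ← BitVec.ofNat_add, ← BitVec.ofNat_add, BitVec.toNat_ofNat,
      Nat.mod_eq_of_lt (by omega)]
  have e3 := hA.sgn s
  have e4 := hA.tab s _ hx
  have e5 : BitVec.ofInt w (A.sgn s) * BitVec.ofNat w x +
      BitVec.ofInt w (A.tab s (A.scale * x)) = BitVec.ofNat w y := by
    rw [← BitVec.ofInt_natCast, ← BitVec.ofInt_natCast, ← hy, BitVec.ofInt_add, BitVec.ofInt_mul]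
  obtain ⟨h0, h1, h2, h3, h4, h5, h8⟩ := h
  simp only [execAll, evalAnswer, List.foldl, Instr.exec, State.write, BinOp.eval,
    Function.update_apply, reduceIte, OfNat.zero_ne_ofNat, OfNat.ofNat_ne_one,
    OfNat.one_ne_ofNat, Nat.reduceEqDiff, zero_ne_one, h0, h1, h4, h5, h8, e1, e2, e3, e4, e5]

/-- Only sums and products of words enter the answer, so it suffices that the integers that are
stored modulo `2 ^ w` give the right answer over the integers. -/
theorem Stored.answers (hA : A.Stored k root addr mem) (q : Bool) (hw : 5 < 2 ^ w) {x y : ℕ}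
    (hk : A.bits * k < 2 ^ w) (hx : x < 2 ^ w) (hy : y < 2 ^ w) (hs : A.scale * x < A.width)
    (hxy : A.sgn (A.stateAfter k x (root q) k) * x +
      A.tab (A.stateAfter k x (root q) k) (A.scale * x) = y) {T : ℝ} (hT : 19 + 5 * (k : ℝ) ≤ T) :
    Answers (query (if q then 5 else 4) k) mem x y T := by
  refine answers_of_isStraight (isStraight_query _ _) (by rw [length_query]; exact_mod_cast hT) ?_
  rw [query, execAll_append, execAll_append, hA.reg_evalAnswer hs
    (hA.registers_readDigits hx hk (hA.registers_loadHeader q hw x) k le_rfl) hxy,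
    BitVec.toNat_ofNat, Nat.mod_eq_of_lt hy]

end DigitAutomaton

end WordRAM

/-! ### Functions that are affine on intervals -/

/-- The numbers below `n` are cut into `ρ` intervals, indexed by `Fin ρ`, on each of which the
function `f` is affine: `piece x` is the interval of `x`, and `start r` is the least element of
the interval `r`. -/
structure AffinePieces (n ρ : ℕ) (f : ℕ → ℕ) where
  piece : ℕ → Fin ρ
  start : Fin ρ → ℕ
  slope : Fin ρ → ℤ
  offset : Fin ρ → ℤ
  start_lt : ∀ r, start r < n
  piece_start : ∀ r, piece (start r) = r
  start_piece_le : ∀ x < n, start (piece x) ≤ x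
  piece_eq : ∀ x y, x ≤ y → y < n → start (piece y) ≤ x → piece x = piece y
  eval : ∀ x < n, slope (piece x) * x + offset (piece x) = (f x : ℤ)

section Runs

variable {n : ℕ} {π : Equiv.Perm (Fin n)} {c : Composition n}

/-- On a run, the permutation is affine with slope `1` or `-1`. -/
theorem IsContiguousStrictRuns.exists_slope (h : IsContiguousStrictRuns π c) (r : Fin c.length) :
    ∃ e o : ℤ, (e = 1 ∨ e = -1) ∧
      ∀ a : Fin (c.blocksFun r),
        ((π (c.embedding r a) : ℕ) : ℤ) = e * (c.embedding r a : ℕ) + o := by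
  have h0 : 0 < c.blocksFun r := c.blocks_pos' _ _
  have key : ∀ e : ℤ, (∀ a b : Fin (c.blocksFun r), (b : ℕ) = a + 1 →
      ((π (c.embedding r b) : ℕ) : ℤ) = (π (c.embedding r a) : ℕ) + e) →
      ∀ a : Fin (c.blocksFun r), ((π (c.embedding r a) : ℕ) : ℤ) =
        e * (c.embedding r a : ℕ) +
          ((π (c.embedding r ⟨0, h0⟩) : ℕ) - e * c.sizeUpTo r) := by
    rintro e he ⟨a, ha⟩
    induction a with
    | zero => simp
    | succ a ih =>
      rw [he ⟨a, by omega⟩ ⟨a + 1, ha⟩ rfl, ih (by omega)]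
      simp only [Composition.coe_embedding]
      push_cast
      ring
  rcases h r with h | h
  · exact ⟨1, _, .inl rfl, key 1 fun a b hab => by rw [h a b hab]; push_cast; ring⟩
  · exact ⟨-1, _, .inr rfl, key (-1) fun a b hab => by rw [← h a b hab]; push_cast; ring⟩

/-- The function on the natural numbers that agrees with `π` below `n`. Larger arguments are
treated like `n - 1`. -/
def permFun (hn : 0 < n) (π : Equiv.Perm (Fin n)) (x : ℕ) : ℕ :=
  π ⟨min x (n - 1), by omega⟩

theorem permFun_coe (hn : 0 < n) (π : Equiv.Perm (Fin n)) (i : Fin n) : permFun hn π i = π i := by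
  have : (⟨min i (n - 1), by omega⟩ : Fin n) = i := Fin.ext (by have := i.isLt; simp; omega)
  rw [permFun, this]

theorem Composition.eq_index_of_le (c : Composition n) {r : Fin c.length} {i : Fin n}
    (h1 : c.sizeUpTo r ≤ i) (h2 : (i : ℕ) < c.sizeUpTo r + c.blocksFun r) : c.index i = r := by
  have : c.embedding r ⟨i - c.sizeUpTo r, by omega⟩ = i := by
    ext; simp only [Composition.coe_embedding]; omega
  rw [← this, c.index_embedding]

theorem Composition.index_bounds (c : Composition n) (i : Fin n) :
    c.sizeUpTo (c.index i) ≤ i ∧ (i : ℕ) < c.sizeUpTo (c.index i) + c.blocksFun (c.index i) := by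
  have h1 := congrArg Fin.val (c.embedding_comp_inv i)
  have h2 := (c.invEmbedding i).isLt
  simp only [Composition.coe_embedding] at h1
  omega

/-- A permutation is affine on each of its runs, and its inverse on the image of each run, which is
an interval because the slope is `1` or `-1`. -/
theorem IsContiguousStrictRuns.affinePieces (hn : 0 < n) (h : IsContiguousStrictRuns π c) :
    Nonempty (AffinePieces n c.length (permFun hn π)) ∧
      Nonempty (AffinePieces n c.length (permFun hn π.symm)) := by
  choose e o he ho using h.exists_slope
  have hlen : ∀ r, 0 < c.blocksFun r := fun r => c.blocks_pos' _ _
  have hlt : ∀ r : Fin c.length, c.sizeUpTo r + c.blocksFun r ≤ n := fun r => by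
    have := (c.embedding r ⟨c.blocksFun r - 1, by have := hlen r; omega⟩).isLt
    have := hlen r
    simp only [Composition.coe_embedding] at *
    omega
  have hπ : ∀ i, ((π i : ℕ) : ℤ) = e (c.index i) * (i : ℕ) + o (c.index i) := fun i => by
    have := ho (c.index i) (c.invEmbedding i)
    rwa [c.embedding_comp_inv] at this
  have hmin : ∀ x, min x (n - 1) < n := fun x => by omega
  have hfin : ∀ x (hx : x < n), (⟨min x (n - 1), hmin x⟩ : Fin n) = ⟨x, hx⟩ := fun x hx =>
    Fin.ext (by simp; omega)
  constructor
  · refine ⟨⟨fun x => c.index ⟨min x (n - 1), hmin x⟩, fun r => c.sizeUpTo r, e, o, ?_, ?_, ?_,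
      ?_, ?_⟩⟩
    · intro r
      have := hlt r
      have := hlen r
      omega
    · intro r
      have := hlt r
      have := hlen r
      rw [hfin _ (by omega)]
      exact c.eq_index_of_le (le_refl (c.sizeUpTo r)) (by simp only; omega)
    · intro x hx
      rw [hfin x hx]
      exact (c.index_bounds ⟨x, hx⟩).1
    · intro x y hxy hy hs
      rw [hfin x (by omega), hfin y hy]
      rw [hfin y hy] at hs
      have := (c.index_bounds ⟨y, hy⟩).2
      exact c.eq_index_of_le hs (by simp only at *; omega)
    · intro x hx
      rw [hfin x hx, ← hπ ⟨x, hx⟩, ← permFun_coe hn π ⟨x, hx⟩]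
  · -- The image of the run `r` starts at the value of `π` at one of the two ends of the run.
    let lo : ∀ r : Fin c.length, Fin n := fun r =>
      if e r = 1 then ⟨c.sizeUpTo r, by have := hlt r; have := hlen r; omega⟩
      else ⟨c.sizeUpTo r + c.blocksFun r - 1, by have := hlt r; have := hlen r; omega⟩
    have hlo : ∀ r, c.index (lo r) = r := fun r => by
      have := hlen r
      simp only [lo]
      split_ifs
      · exact c.eq_index_of_le le_rfl (by simp only; omega)
      · exact c.eq_index_of_le (by simp only; omega) (by simp only; omega)
    -- The values on a run fill the interval that begins there.
    have hcon : ∀ i (y : ℕ), (π (lo (c.index i)) : ℕ) ≤ y → y ≤ π i →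
        ∃ i', (π i' : ℕ) = y ∧ c.index i' = c.index i := by
      intro i y h1 h2
      have h3 := hπ i
      have h4 := hπ (lo (c.index i))
      rw [hlo] at h4
      have h5 := c.index_bounds i
      obtain ⟨x, hx1, hx2, hx3⟩ : ∃ x : ℕ, c.sizeUpTo (c.index i) ≤ x ∧
          x < c.sizeUpTo (c.index i) + c.blocksFun (c.index i) ∧
          e (c.index i) * x + o (c.index i) = (y : ℤ) := by
        simp only [lo] at h1 h4
        rcases he (c.index i) with he | he
        · rw [he] at h3 h4 ⊢
          simp only [he, if_true] at h1 h4
          exact ⟨(y - o (c.index i)).toNat, by omega, by omega, by omega⟩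
        · rw [he] at h3 h4 ⊢
          have hne : ¬ ((-1 : ℤ) = 1) := by decide
          simp only [he, if_neg hne] at h1 h4
          exact ⟨(o (c.index i) - y).toNat, by omega, by omega, by omega⟩
      have hxn : x < n := by have := hlt (c.index i); omega
      have hidx : c.index ⟨x, hxn⟩ = c.index i := c.eq_index_of_le hx1 hx2
      refine ⟨⟨x, hxn⟩, ?_, hidx⟩
      have := hπ ⟨x, hxn⟩
      rw [hidx] at this
      exact_mod_cast this.trans hx3
    refine ⟨⟨fun y => c.index (π.symm ⟨min y (n - 1), hmin y⟩), fun r => π (lo r), e,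
      fun r => -(e r * o r), fun r => (π (lo r)).isLt, ?_, ?_, ?_, ?_⟩⟩
    · intro r
      rw [hfin _ (π (lo r)).isLt, Fin.eta, Equiv.symm_apply_apply, hlo]
    · intro y hy
      rw [hfin y hy]
      generalize hi : π.symm ⟨y, hy⟩ = i
      rw [Equiv.symm_apply_eq] at hi
      have h3 := hπ i
      have h4 := hπ (lo (c.index i))
      have h5 := c.index_bounds i
      have h6 : y = π i := congrArg Fin.val hi
      rw [hlo] at h4
      simp only [lo] at h4 ⊢
      rcases he (c.index i) with he | he
      · rw [he] at h3 h4
        simp only [he, if_true] at h4 ⊢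
        omega
      · rw [he] at h3 h4
        have hne : ¬ ((-1 : ℤ) = 1) := by decide
        simp only [he, if_neg hne] at h4 ⊢
        omega
    · intro x y hxy hy hs
      rw [hfin y hy] at hs ⊢
      rw [hfin x (by omega)]
      obtain ⟨i', h1, h2⟩ := hcon (π.symm ⟨y, hy⟩) x hs (by simpa using hxy)
      rw [← h2, ← (Equiv.symm_apply_eq π).2 (Fin.ext h1.symm : (⟨x, by omega⟩ : Fin n) = π i')]
    · intro y hy
      rw [hfin y hy, permFun, hfin y hy]
      generalize hi : π.symm ⟨y, hy⟩ = i
      rw [Equiv.symm_apply_eq] at hi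
      have h3 := hπ i
      have h6 : y = π i := congrArg Fin.val hi
      rcases he (c.index i) with he | he <;> rw [he] at h3 ⊢ <;> omega

end Runs

open WordRAM

/-! ### The radix trie over the starting points of the intervals -/

namespace AffinePieces

variable {n ρ : ℕ} {f : ℕ → ℕ}

/-- The states are the nodes of the radix trie with `k` levels over the starting points. For
`j < k`, the state `(j, r)` is the block of numbers that have the same first `j` digits as
`start r`. The state `(k, r)` is reached once it is known that the argument lies in the interval
`r`, and is not left again. The child of a block is again a block if a starting point lies in it;
otherwise it lies in the interval of its last element. -/
def next (D : AffinePieces n ρ f) (b k : ℕ) (s : Fin (k + 1) × Fin ρ) (d : ℕ) :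
    Fin (k + 1) × Fin ρ :=
  if h : (s.1 : ℕ) < k then
    let S := 2 ^ (b * (k - (s.1 + 1)))
    let p := D.start s.2 / 2 ^ (b * (k - s.1)) * 2 ^ b + d
    let r := D.piece (min ((p + 1) * S - 1) (n - 1))
    if D.start r / S = p then (⟨s.1 + 1, by omega⟩, r) else (Fin.last k, r)
  else s

/-- The state `s` fits the argument `x` after `j` of `k` digits: it names the interval of `x`, or it
is the block of `x` at level `j`. -/
def Fits (D : AffinePieces n ρ f) (b k x j : ℕ) (s : Fin (k + 1) × Fin ρ) : Prop :=
  s = (Fin.last k, D.piece x) ∨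
    ((s.1 : ℕ) = j ∧ D.start s.2 / 2 ^ (b * (k - j)) = x / 2 ^ (b * (k - j)))

/-- The first alternative persists, since `(k, r)` is not left. From the second one, the digit leads
to the block of `x` one level down. If no starting point of an interval lies in that block, then `x`
lies in the same interval as the last element of the block. -/
theorem Fits.next {D : AffinePieces n ρ f} {b k x j : ℕ} {s : Fin (k + 1) × Fin ρ}
    (hx : x < n) (hj : j < k) (h : D.Fits b k x j s) :
    D.Fits b k x (j + 1) (D.next b k s (x / 2 ^ (b * (k - (j + 1))) % 2 ^ b)) := by
  rcases h with rfl | ⟨h1, h2⟩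
  · exact .inl (by simp [AffinePieces.next])
  have hexp : 2 ^ (b * (k - j)) = 2 ^ (b * (k - (j + 1))) * 2 ^ b := by
    rw [← pow_add, ← Nat.mul_succ]; congr 2; omega
  have hp : D.start s.2 / 2 ^ (b * (k - j)) * 2 ^ b + x / 2 ^ (b * (k - (j + 1))) % 2 ^ b =
      x / 2 ^ (b * (k - (j + 1))) := by
    rw [h2, hexp, ← Nat.div_div_eq_div_mul, Nat.div_add_mod']
  simp only [AffinePieces.next, h1, hj, dif_pos, hp]
  have hS : 0 < 2 ^ (b * (k - (j + 1))) := by positivity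
  generalize hSdef : 2 ^ (b * (k - (j + 1))) = S at *
  have hxS : x < (x / S + 1) * S := by
    rw [mul_comm]; exact Nat.lt_mul_div_succ x hS
  -- `y` is the last element of the block of `x`, or `n - 1` if the block is cut off there.
  generalize hy : min ((x / S + 1) * S - 1) (n - 1) = y
  have hyn : y < n := by omega
  have hxy : x ≤ y := by omega
  split_ifs with hs
  · exact .inr ⟨rfl, by rwa [hSdef]⟩
  · suffices h : D.start (D.piece y) ≤ x from .inl (by rw [D.piece_eq x y hxy hyn h])
    have h3 : D.start (D.piece y) / S ≤ x / S := by
      rw [← Nat.lt_succ_iff, Nat.div_lt_iff_lt_mul hS]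
      have := D.start_piece_le y hyn
      show _ < (x / S + 1) * S
      omega
    have h4 : D.start (D.piece y) / S < x / S := lt_of_le_of_ne h3 hs
    by_contra! h5
    exact absurd (Nat.div_le_div_right (c := S) h5.le) (by omega)

/-- After all digits, blocks have one element, so `x` itself is the starting point of `s.2`. -/
theorem Fits.eq_last {D : AffinePieces n ρ f} {b k x : ℕ} {s : Fin (k + 1) × Fin ρ}
    (h : D.Fits b k x k s) : s = (Fin.last k, D.piece x) := by
  rcases h with h | ⟨h1, h2⟩
  · exact h
  · simp only [Nat.sub_self, mul_zero, pow_zero, Nat.div_one] at h2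
    rw [← h2, D.piece_start]
    exact Prod.ext (Fin.ext h1) rfl

/-- The tries for the two functions `f q`, side by side. -/
def trie {f : Bool → ℕ → ℕ} (D : ∀ q, AffinePieces n ρ (f q)) (b k : ℕ) :
    DigitAutomaton (Bool × (Fin (k + 1) × Fin ρ)) where
  bits := b
  width := 1
  scale := 0
  next s d := (s.1, (D s.1).next b k s.2 d)
  sgn s := (D s.1).slope s.2.2
  tab s _ := (D s.1).offset s.2.2

/-- Both tries begin at a state `(0, r)` with arbitrary `r`, as the block of level `0` contains
everything below `n`. -/
theorem stateAfter_trie {f : Bool → ℕ → ℕ} (D : ∀ q, AffinePieces n ρ (f q)) {b k x : ℕ}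
    (hn : n ≤ 2 ^ (b * k)) (hx : x < n) (q : Bool) (r : Fin ρ) :
    (trie D b k).stateAfter k x (q, (0, r)) k = (q, (Fin.last k, (D q).piece x)) := by
  have key : ∀ j ≤ k, ∃ s, (trie D b k).stateAfter k x (q, (0, r)) j = (q, s) ∧
      (D q).Fits b k x j s := by
    intro j hj
    induction j with
    | zero =>
      refine ⟨_, rfl, .inr ⟨rfl, ?_⟩⟩
      have := (D q).start_lt r
      rw [Nat.div_eq_of_lt (by simp only [Nat.sub_zero]; omega),
        Nat.div_eq_of_lt (by simp only [Nat.sub_zero]; omega)]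
    | succ j ih =>
      obtain ⟨s, hs, hfit⟩ := ih (by omega)
      exact ⟨_, by rw [DigitAutomaton.stateAfter, hs]; rfl, hfit.next hx hj⟩
  obtain ⟨s, hs, hfit⟩ := key k le_rfl
  rw [hs, hfit.eq_last]

end AffinePieces

/-! ### The table of all values -/

/-- The automaton with a table of all values of `f q` in the state `q`. Its digits have no bits. -/
def tableAutomaton (n : ℕ) (f : Bool → ℕ → ℕ) : DigitAutomaton Bool where
  bits := 0
  width := n
  scale := 1
  next s _ := s
  sgn _ := 0
  tab s z := f s z

theorem stateAfter_tableAutomaton (n : ℕ) (f : Bool → ℕ → ℕ) (k x : ℕ) (q : Bool) (j : ℕ) :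
    (tableAutomaton n f).stateAfter k x q j = q := by
  induction j with
  | zero => rfl
  | succ j ih => exact ih

/-! ### Size of the data structure -/

/-- The trie is used if it has at most `n` words for each function, the table of all values
otherwise. So the addresses fit into words even if the bound on the size of the trie does not. -/
theorem AffinePieces.exists_memory {n ρ : ℕ} {f : Bool → ℕ → ℕ}
    (D : ∀ q, AffinePieces n ρ (f q)) (hn : 0 < n) (hf : ∀ q, ∀ x < n, f q x < n) {k w : ℕ}
    (hk : 0 < k) (hw : Nat.log 2 n + 5 ≤ w) :
    ∃ mem : List (BitVec w),
      mem.length ≤ 10 + 2 * ((k + 1) * ρ * (2 ^ (Nat.log 2 n / k + 1) + 2)) ∧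
      ∀ q, ∀ x < n, ∀ T : ℝ, 19 + 5 * (k : ℝ) ≤ T →
        Answers (query (if q then 5 else 4) k) mem x (f q x) T := by
  have hnlog : n < 2 * 2 ^ Nat.log 2 n := by
    rw [← pow_succ']; exact Nat.lt_pow_succ_log_self one_lt_two n
  have hw32 : 32 * 2 ^ Nat.log 2 n ≤ 2 ^ w := by
    calc 32 * 2 ^ Nat.log 2 n = 2 ^ (Nat.log 2 n + 5) := by rw [pow_add]; ring
      _ ≤ 2 ^ w := Nat.pow_le_pow_right two_pos hw
  generalize hb : Nat.log 2 n / k + 1 = b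
  by_cases h : (k + 1) * ρ * (2 ^ b + 2) ≤ n
  · have hρ : 0 < ρ := ((D true).piece 0).pos
    have hcard : Fintype.card (Bool × (Fin (k + 1) × Fin ρ)) * (trie D b k).nodeSize =
        2 * ((k + 1) * ρ * (2 ^ b + 2)) := by
      simp [DigitAutomaton.nodeSize, trie]; ring
    obtain ⟨mem, addr, hlen, hmem⟩ := (trie D b k).exists_stored (w := w) k
      (fun q => (q, (0, ⟨0, hρ⟩))) (by rw [hcard]; omega)
    have hbk : (trie D b k).bits * k < 2 ^ w := by
      have h1 : b * k ≤ (2 ^ b + 2) * ((k + 1) * ρ) := by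
        have := (Nat.lt_two_pow_self (n := b)).le
        exact Nat.mul_le_mul (by omega) (Nat.le_mul_of_pos_right _ hρ |>.trans' (by omega))
      rw [mul_comm (2 ^ b + 2)] at h1
      show b * k < 2 ^ w
      omega
    have hnbk : n ≤ 2 ^ (b * k) := by
      have h1 : Nat.log 2 n + 1 ≤ b * k := by
        rw [← hb, mul_comm]
        exact Nat.lt_mul_div_succ _ hk
      calc n ≤ 2 ^ (Nat.log 2 n + 1) := by rw [pow_succ']; omega
        _ ≤ 2 ^ (b * k) := Nat.pow_le_pow_right two_pos h1
    refine ⟨mem, by rw [hlen, hcard]; omega, fun q x hx T hT => ?_⟩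
    have hfx := hf q x hx
    refine hmem.answers q (by omega) hbk (by omega) (by omega) (by simp [trie]) ?_ hT
    rw [stateAfter_trie D hnbk hx]
    exact (D q).eval x hx
  · have hcard : Fintype.card Bool * (tableAutomaton n f).nodeSize = 2 * (2 + n) := by
      simp [DigitAutomaton.nodeSize, tableAutomaton]
    obtain ⟨mem, addr, hlen, hmem⟩ := (tableAutomaton n f).exists_stored (w := w) k
      (fun q => q) (by rw [hcard]; omega)
    refine ⟨mem, by rw [hlen, hcard]; omega, fun q x hx T hT => ?_⟩
    have hfx := hf q x hx
    refine hmem.answers q (by omega) (by simp [tableAutomaton]) (by omega) (by omega)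
      (by simpa [tableAutomaton] using hx) ?_ hT
    rw [stateAfter_tableAutomaton]
    simp [tableAutomaton]

/-- A factor `n ^ (ε / 2)` pays for the tables of the trie, another one for the word length. -/
theorem size_bound {ε : ℝ} (hε : 0 < ε) {k : ℕ} (hk : 2 / ε ≤ k) {n ρ w d M : ℕ} (hn : 0 < n)
    (hρ : 0 < ρ) (hw : w ≤ d * (Nat.log 2 n + 1))
    (hM : M ≤ 10 + 2 * ((k + 1) * ρ * (2 ^ (Nat.log 2 n / k + 1) + 2))) :
    ((M * w : ℕ) : ℝ) ≤ (18 + 8 * k) * d * (4 / ε + 1) * (ρ * (n : ℝ) ^ ε) := by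
  have hn1 : (1 : ℝ) ≤ n := by exact_mod_cast hn
  have hρ1 : (1 : ℝ) ≤ ρ := by exact_mod_cast hρ
  have hk0 : (0 : ℝ) < k := lt_of_lt_of_le (by positivity) hk
  have hY : (1 : ℝ) ≤ (n : ℝ) ^ (ε / 2) := Real.one_le_rpow hn1 (by positivity)
  have hlog2 : (2 : ℝ) ^ Nat.log 2 n ≤ n := by exact_mod_cast Nat.pow_log_le_self 2 hn.ne'
  have hpow : (2 : ℝ) ^ (Nat.log 2 n / k) ≤ (n : ℝ) ^ (ε / 2) := by
    have h1 : ((2 : ℝ) ^ (Nat.log 2 n / k)) ^ k ≤ n := by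
      rw [← pow_mul]
      exact (pow_le_pow_right₀ one_le_two (Nat.div_mul_le_self _ _)).trans hlog2
    have h2 : (2 : ℝ) ^ (Nat.log 2 n / k) ≤ (n : ℝ) ^ (1 / (k : ℝ)) := by
      rw [one_div, Real.le_rpow_inv_iff_of_pos (by positivity) (by positivity) hk0,
        Real.rpow_natCast]
      exact h1
    refine h2.trans (Real.rpow_le_rpow_of_exponent_le hn1 ?_)
    rw [div_le_iff₀ hε] at hk
    rw [div_le_iff₀ hk0]
    linarith
  have hlog : ((Nat.log 2 n + 1 : ℕ) : ℝ) ≤ (4 / ε + 1) * (n : ℝ) ^ (ε / 2) := by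
    have h1 : (Nat.log 2 n : ℝ) * Real.log 2 ≤ (n : ℝ) ^ (ε / 2) / (ε / 2) := by
      rw [← Real.log_pow]
      exact (Real.log_le_log (by positivity) hlog2).trans
        (Real.log_le_rpow_div (by positivity) (by positivity))
    have h2 : (Nat.log 2 n : ℝ) * (1 / 2) ≤ Nat.log 2 n * Real.log 2 :=
      mul_le_mul_of_nonneg_left (by have := Real.log_two_gt_d9; linarith) (by positivity)
    have h3 : (n : ℝ) ^ (ε / 2) / (ε / 2) = 2 / ε * (n : ℝ) ^ (ε / 2) := by
      field_simp
    have h4 : 4 / ε * (n : ℝ) ^ (ε / 2) = 2 * (2 / ε * (n : ℝ) ^ (ε / 2)) := by ring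
    push_cast
    rw [add_mul, one_mul, h4]
    linarith
  have hsq : (n : ℝ) ^ ε = (n : ℝ) ^ (ε / 2) * (n : ℝ) ^ (ε / 2) := by
    rw [← Real.rpow_add (by positivity), add_halves]
  generalize (n : ℝ) ^ (ε / 2) = Y at *
  have hY0 : 0 ≤ Y := by linarith
  have hM' : (M : ℝ) ≤ (18 + 8 * k) * (ρ * Y) := by
    have h1 : (M : ℝ) ≤ 10 + 2 * ((k + 1) * ρ * (2 ^ (Nat.log 2 n / k) * 2 + 2)) := by
      rw [← pow_succ]; exact_mod_cast hM
    have h2 : (k + 1) * (ρ : ℝ) * (2 ^ (Nat.log 2 n / k) * 2 + 2) ≤ (k + 1) * ρ * (4 * Y) :=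
      mul_le_mul_of_nonneg_left (by linarith) (by positivity)
    have h3 : (1 : ℝ) ≤ ρ * Y := one_le_mul_of_one_le_of_one_le hρ1 hY
    nlinarith
  have hw' : (w : ℝ) ≤ d * ((4 / ε + 1) * Y) := by
    calc (w : ℝ) ≤ d * ((Nat.log 2 n + 1 : ℕ) : ℝ) := by exact_mod_cast hw
      _ ≤ _ := mul_le_mul_of_nonneg_left hlog (by positivity)
  rw [hsq]
  push_cast
  calc (M : ℝ) * w ≤ ((18 + 8 * k) * (ρ * Y)) * (d * ((4 / ε + 1) * Y)) :=
        mul_le_mul hM' hw' (by positivity) (by positivity)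
    _ = _ := by ring

theorem theorem7 :
    ∃ (C : ℝ) (c : ℕ), ∀ ε : ℝ, 0 < ε →
      ∃ P Q : WordRAM.Program, ∀ d : ℕ, ∃ K : ℝ,
        ∀ (n w : ℕ), Nat.log 2 n + c ≤ w → w ≤ d * (Nat.log 2 n + 1) →
          ∀ (π : Equiv.Perm (Fin n)) (runs : Composition n), IsContiguousStrictRuns π runs →
            ∃ mem : List (BitVec w),
              ((mem.length * w : ℕ) : ℝ) ≤ K * ((runs.length : ℝ) * (n : ℝ) ^ ε) ∧
              ∀ i : Fin n,
                WordRAM.Answers P mem i (π i) (C * (1 + 1 / ε)) ∧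
                WordRAM.Answers Q mem i (π.symm i) (C * (1 + 1 / ε)) := by
  refine ⟨24, 5, fun ε hε => ?_⟩
  have hk : 2 / ε ≤ (⌈2 / ε⌉₊ : ℕ) := Nat.le_ceil _
  have hk0 : 0 < ⌈2 / ε⌉₊ := Nat.ceil_pos.2 (by positivity)
  have hT : 19 + 5 * (⌈2 / ε⌉₊ : ℝ) ≤ 24 * (1 + 1 / ε) := by
    have h1 := (Nat.ceil_lt_add_one (a := 2 / ε) (by positivity)).le
    have h2 : 2 / ε = 2 * (1 / ε) := by ring
    have h3 : 0 < 1 / ε := by positivity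
    linarith
  generalize ⌈2 / ε⌉₊ = k at *
  refine ⟨query 4 k, query 5 k, fun d => ⟨(18 + 8 * k) * d * (4 / ε + 1),
    fun n w hw hwd π runs h => ?_⟩⟩
  rcases Nat.eq_zero_or_pos n with rfl | hn
  · refine ⟨[], ?_, fun i => i.elim0⟩
    rw [List.length_nil, zero_mul, Nat.cast_zero]
    positivity
  obtain ⟨⟨D₁⟩, ⟨D₂⟩⟩ := h.affinePieces hn
  obtain ⟨mem, hlen, hmem⟩ := AffinePieces.exists_memory
    (f := fun q => permFun hn (if q then π.symm else π))
    (fun q => match q with | false => D₁ | true => D₂) hn (fun q x _ => Fin.isLt _) hk0 hw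
  refine ⟨mem, size_bound hε hk hn (D₁.piece 0).pos hwd hlen, fun i => ⟨?_, ?_⟩⟩
  · rw [← permFun_coe hn π i]
    exact hmem false i i.isLt _ hT
  · rw [← permFun_coe hn π.symm i]
    exact hmem true i i.isLt _ hT
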